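/- Let $(X,\|\cdot\|)$ be a non-reflexive real Banach space. Then there exist an equivalent norm $|\!|\!|\cdot|\!|\!|$ on $X$ and a point $x\in X$ with $|\!|\!|x|\!|\!|=1$ which is NSE but not $w$-aLUR, and hence not aLUR, in $E:=(X,|\!|\!|\cdot|\!|\!|)$. Here $B_E$, $S_E$ are the closed unit ball and unit sphere of $E$, $S_{E^*}$ is the unit sphere of the dual of $E$, and, for $x\in S_E$: - $x$ is NSE (nicely strongly exposed) if, for every $x^*\in S_{E^*}$ with $x^*(x)=1$, every sequence $(x_n)_n\subset B_E$ with $\lim_n x^*(x_n)=1$ converges in norm to $x$; - $x$ is aLUR (almost locally uniformly rotund) if, whenever $(x_n)_n\subset S_E$ and $(x_m^*)_m\subset S_{E^*}$ are sequences such that the limit $\alpha_m:=\lim_n x_m^*\bigl(\tfrac{x_n+x}{2}\bigr)$ exists for every $m$ and $\lim_m\alpha_m=1$, the sequence $(x_n)_n$ converges in norm to $x$; - $x$ is $w$-aLUR if, for all such sequences, $(x_n)_n$ converges weakly to $x$. -/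

import Mathlib

open Filter Topology

/-- A normed space is reflexive if the canonical embedding into its bidual is onto. -/
def IsReflexiveSpace (X : Type*) [NormedAddCommGroup X] [NormedSpace ℝ X] : Prop :=
  Function.Surjective (NormedSpace.inclusionInDoubleDual ℝ X)

/-- An equivalent norm on the real normed space `X`: a seminorm bounded above and below by
positive multiples of the original norm. -/
structure EquivNorm (X : Type*) [NormedAddCommGroup X] [NormedSpace ℝ X]
    extends Seminorm ℝ X where
  equiv' : ∃ c C : ℝ, 0 < c ∧ 0 < C ∧
    ∀ x : X, c * ‖x‖ ≤ toSeminorm x ∧ toSeminorm x ≤ C * ‖x‖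

namespace EquivNorm

variable {X : Type*} [NormedAddCommGroup X] [NormedSpace ℝ X]

theorem eq_zero (N : EquivNorm X) (x : X) (hx : N.toSeminorm x = 0) : x = 0 := by
  obtain ⟨c, C, hc, -, h⟩ := N.equiv'
  have h1 := (h x).1
  rw [hx] at h1
  have h2 : ‖x‖ ≤ 0 := by
    by_contra hne
    push Not at hne
    have := mul_pos hc hne
    linarith
  exact norm_le_zero_iff.mp h2

/-- The vector space `X` (the same set with the same vector operations), to be equipped with the
equivalent norm `N` in place of the original one. -/
def Space (_N : EquivNorm X) : Type _ := X

instance (N : EquivNorm X) : AddCommGroup N.Space := inferInstanceAs (AddCommGroup X)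

instance (N : EquivNorm X) : Module ℝ N.Space := inferInstanceAs (Module ℝ X)

/-- The identity map from `X` to `X` renormed by `N`. -/
def toSpace (N : EquivNorm X) : X ≃ₗ[ℝ] N.Space := LinearEquiv.refl ℝ X

instance (N : EquivNorm X) : Norm N.Space := ⟨fun x => N.toSeminorm (N.toSpace.symm x)⟩

theorem core (N : EquivNorm X) : NormedSpace.Core ℝ N.Space where
  norm_nonneg x := apply_nonneg N.toSeminorm _
  norm_smul c x := map_smul_eq_mul N.toSeminorm c (N.toSpace.symm x)
  norm_triangle x y := map_add_le_add N.toSeminorm (N.toSpace.symm x) (N.toSpace.symm y)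
  norm_eq_zero_iff x :=
    ⟨fun h => N.eq_zero _ h, fun h => by subst h; exact map_zero N.toSeminorm⟩

noncomputable instance (N : EquivNorm X) : NormedAddCommGroup N.Space :=
  NormedAddCommGroup.ofCore N.core

noncomputable instance (N : EquivNorm X) : NormedSpace ℝ N.Space :=
  NormedSpace.ofCore N.core

theorem norm_toSpace (N : EquivNorm X) (x : X) : ‖N.toSpace x‖ = N.toSeminorm x := rfl

end EquivNorm

section Rotundity

variable {E : Type*} [NormedAddCommGroup E] [NormedSpace ℝ E]

/-- The (normalized) duality map: norm-one functionals taking the value `1` at `x`. -/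
def dualityMap (x : E) : Set (StrongDual ℝ E) :=
  {f | ‖f‖ = 1 ∧ f x = 1}

/-- `x` is strongly exposed by the functional `f`: every sequence in the closed unit ball
along which `f` tends to `1` converges to `x`. -/
def IsStronglyExposedBy (x : E) (f : StrongDual ℝ E) : Prop :=
  ∀ u : ℕ → E, (∀ n, ‖u n‖ ≤ 1) →
    Tendsto (fun n => f (u n)) atTop (𝓝 1) → Tendsto u atTop (𝓝 x)

/-- Nicely strongly exposed (NSE): strongly exposed by every functional of the duality map.
To be used for `x` on the unit sphere. -/
def IsNSE (x : E) : Prop :=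
  ∀ f ∈ dualityMap x, IsStronglyExposedBy x f

/-- The iterated limit `lim_m (lim_n f m ((u n + x) / 2))` exists (the inner limit for every `m`)
and equals `1`. -/
def IteratedLimitOne (x : E) (u : ℕ → E) (f : ℕ → StrongDual ℝ E) : Prop :=
  ∃ α : ℕ → ℝ,
    (∀ m, Tendsto (fun n => f m ((1 / 2 : ℝ) • (u n + x))) atTop (𝓝 (α m))) ∧
      Tendsto α atTop (𝓝 1)

/-- Almost locally uniformly rotund (aLUR). To be used for `x` on the unit sphere. -/
def IsALUR (x : E) : Prop :=
  ∀ (u : ℕ → E) (f : ℕ → StrongDual ℝ E), (∀ n, ‖u n‖ = 1) → (∀ m, ‖f m‖ = 1) →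
    IteratedLimitOne x u f → Tendsto u atTop (𝓝 x)

/-- Weakly almost locally uniformly rotund (w-aLUR). To be used for `x` on the unit sphere. -/
def IsWeakALUR (x : E) : Prop :=
  ∀ (u : ℕ → E) (f : ℕ → StrongDual ℝ E), (∀ n, ‖u n‖ = 1) → (∀ m, ‖f m‖ = 1) →
    IteratedLimitOne x u f →
      Tendsto (fun n => toWeakSpace ℝ E (u n)) atTop (𝓝 (toWeakSpace ℝ E x))

end Rotundity

/-!
A non-reflexive space contains a triangular system of James: bounded sequences of vectors
`x n` and functionals `g m` with `g m (x n) = 1` for `m ≤ n` and `g m (x n) = 0` for `n < m`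
(`exists_jamesSystem`, by Helly's theorem). Put `e = x 0`, `f = g 0 - g 1`, so that `f e = 1` and
`f` vanishes at the other `x n`; let `Z` be the span of the system, and let the weights `a m < 1`
increase to `1`. The new norm is

`N z = √(max (A z) (p z) ^ 2 + dist (z, Z) ^ 2)`, with `A z = √(|f z| ^ 2 + c ^ 2 ‖z - f z • e‖ ^ 2)`
and `p z = sup_m a m * |f z + g (m + 1) z|`.

The part `p` destroys almost rotundity in a way that functionals norming `e` do not see.

* The functionals `a m • (f + g (m + 1))` have norm one, take the value `a m` at `e`, and tend
  along the unit vectors `x (n + 1) / a n` to `a m`. Hence the iterated limit is `1`, although `f`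
  vanishes along these vectors and `f e = 1` (`JamesSystem.not_isWeakALUR`).
* Along a direction `w` in `Z` with `f w = 0` all but finitely many `g m w` vanish, and each
  remaining term of `p` is less than `1` near `e`; so `N (e + s • w) ≤ 1 + O(s ^ 2)`. A functional
  `h` norming `e` therefore agrees with `f` on `Z` (`JamesSystem.apply_eq_exposing`). If `h (u n)`
  tends to `1` in the unit ball, the quadratic distance term makes `u n` approach `Z`, hence
  `f (u n)` tends to `1`, and `A` makes `u n` converge to `e` (`JamesSystem.tendsto_renorm_sub`).

The distance term is needed because off `Z` the functionals `g m` need not tend pointwise to `0`,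
so that `e` may have many norming functionals.
-/

/-! ### Triangular systems in non-reflexive spaces -/

/-- **Helly's theorem** on finite systems of linear equations: on finitely many functionals, an
element `F` of the bidual agrees with a vector of norm at most `‖F‖ + 1`. -/
theorem exists_norm_le_forall_apply_eq {Y ι : Type*} [NormedAddCommGroup Y] [NormedSpace ℝ Y]
    [Finite ι] (φ : ι → StrongDual ℝ Y) (F : StrongDual ℝ (StrongDual ℝ Y)) :
    ∃ y : Y, ‖y‖ ≤ ‖F‖ + 1 ∧ ∀ i, φ i y = F (φ i) := by
  classical
  have := Fintype.ofFinite ι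
  have hsingle : ∀ i : ι, (fun j => if i = j then (1 : ℝ) else 0) = Pi.single i 1 := fun i => by
    ext j
    simp [Pi.single_apply, eq_comm]
  -- The system is solvable: a linear relation between the `φ i` is also one between the `F (φ i)`.
  obtain ⟨y₀, hy₀⟩ : ∃ y₀ : Y, ∀ i, φ i y₀ = F (φ i) := by
    let L : Y →ₗ[ℝ] (ι → ℝ) := LinearMap.pi fun i => (φ i).toLinearMap
    by_contra hcon
    have hv : (fun i => F (φ i)) ∉ LinearMap.range L := by
      rintro ⟨y, hy⟩
      exact hcon ⟨y, fun i => congrFun hy i⟩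
    obtain ⟨ψ, hψv, hψ⟩ := Submodule.exists_le_ker_of_notMem hv
    have hrel : ∑ i, ψ (Pi.single i 1) • φ i = 0 := by
      ext y
      have h0 : ψ (L y) = 0 := hψ ⟨y, rfl⟩
      rw [ψ.pi_apply_eq_sum_univ] at h0
      simp only [hsingle] at h0
      simpa [_root_.sum_apply, L, mul_comm] using h0
    apply hψv
    rw [ψ.pi_apply_eq_sum_univ]
    simp only [hsingle]
    have := congrArg F hrel
    simpa [map_sum, mul_comm] using this
  let K : Submodule ℝ Y := ⨅ i, LinearMap.ker (φ i).toLinearMap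
  -- The distance from `y₀` to the common kernel is computed by a combination of the `φ i`.
  have hdist : ‖(Submodule.Quotient.mk y₀ : Y ⧸ K)‖ ≤ ‖F‖ := by
    obtain ⟨h, hh, hhy⟩ := exists_dual_vector'' ℝ (Submodule.Quotient.mk y₀ : Y ⧸ K)
    have hbound : ∀ y : Y, ‖(h.toLinearMap.comp K.mkQ) y‖ ≤ 1 * ‖y‖ := fun y => by
      refine (h.le_opNorm _).trans ?_
      exact mul_le_mul hh (Submodule.Quotient.norm_mk_le K y) (norm_nonneg _) zero_le_one
    let k : StrongDual ℝ Y := (h.toLinearMap.comp K.mkQ).mkContinuous 1 hbound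
    have hk : ‖k‖ ≤ 1 := LinearMap.mkContinuous_norm_le _ zero_le_one _
    have hky : k y₀ = ‖(Submodule.Quotient.mk y₀ : Y ⧸ K)‖ := hhy
    have hspan : k.toLinearMap ∈ Submodule.span ℝ (Set.range fun i => (φ i).toLinearMap) := by
      refine mem_span_of_iInf_ker_le_ker fun y hy => ?_
      have : (Submodule.Quotient.mk y : Y ⧸ K) = 0 := (Submodule.Quotient.mk_eq_zero K).2 hy
      change h (Submodule.Quotient.mk y) = 0
      rw [this, map_zero]
    obtain ⟨c, hc⟩ := (Submodule.mem_span_range_iff_exists_fun ℝ).1 hspan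
    have hk' : k = ∑ i, c i • φ i := by
      ext y
      have := LinearMap.congr_fun hc y
      simpa [_root_.sum_apply, LinearMap.sum_apply] using this.symm
    have hFk : F k = k y₀ := by
      rw [hk']
      simp [hy₀]
    rw [← hky, ← hFk]
    exact (le_abs_self _).trans ((F.le_opNorm k).trans
      (mul_le_of_le_one_right (norm_nonneg _) hk))
  obtain ⟨y, hy, hlt⟩ :=
    Submodule.Quotient.norm_mk_lt (Submodule.Quotient.mk y₀ : Y ⧸ K) zero_lt_one
  refine ⟨y, by linarith, fun i => ?_⟩
  have hmem : y - y₀ ∈ K := (Submodule.Quotient.eq K).1 hy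
  have : φ i (y - y₀) = 0 := (Submodule.mem_iInf _).1 hmem i
  rw [← hy₀ i]
  simpa [sub_eq_zero] using this

/-- Helly's theorem for finite sets of functionals, with an unspecified bound. -/
theorem exists_bound_forall_finset_apply_eq {Y : Type*} [NormedAddCommGroup Y] [NormedSpace ℝ Y]
    (F : StrongDual ℝ (StrongDual ℝ Y)) :
    ∃ C : ℝ, ∀ s : Finset (StrongDual ℝ Y), ∃ y : Y, ‖y‖ ≤ C ∧ ∀ φ ∈ s, φ y = F φ :=
  ⟨‖F‖ + 1, fun s => (exists_norm_le_forall_apply_eq (fun i : s => i.1) F).imp fun _ hy =>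
    ⟨hy.1, fun φ hφ => hy.2 ⟨φ, hφ⟩⟩⟩

theorem exists_dual_ne_zero_of_notMem {V : Type*} [NormedAddCommGroup V] [NormedSpace ℝ V]
    {R : Submodule ℝ V} (hR : IsClosed (R : Set V)) {v : V} (hv : v ∉ R) :
    ∃ ψ : StrongDual ℝ V, ψ v ≠ 0 ∧ ∀ w ∈ R, ψ w = 0 := by
  have hne : ‖(Submodule.Quotient.mk v : V ⧸ R)‖ ≠ 0 := fun h0 => by
    have hmem : v ∈ closure (R : Set V) := QuotientAddGroup.norm_mk_eq_zero_iff_mem_closure.1 h0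
    rw [hR.closure_eq] at hmem
    exact hv hmem
  obtain ⟨h, -, hh⟩ := exists_dual_vector ℝ (Submodule.Quotient.mk v : V ⧸ R) hne
  refine ⟨h.comp R.mkQL, ?_, fun w hw => ?_⟩
  · change h (Submodule.Quotient.mk v) ≠ 0
    rw [hh]
    exact hne
  · change h (Submodule.Quotient.mk w) = 0
    rw [(Submodule.Quotient.mk_eq_zero R).2 hw, map_zero]

/-- A triangular system of James: bounded sequences of vectors `x n` and functionals `g m` with
`g m (x n) = 1` for `m ≤ n` and `g m (x n) = 0` for `n < m`. -/
structure JamesSystem (X : Type*) [NormedAddCommGroup X] [NormedSpace ℝ X] where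
  /-- The vectors of the system. -/
  x : ℕ → X
  /-- The functionals of the system. -/
  g : ℕ → StrongDual ℝ X
  /-- A common bound for the norms. -/
  bound : ℝ
  norm_x_le : ∀ n, ‖x n‖ ≤ bound
  norm_g_le : ∀ m, ‖g m‖ ≤ bound
  g_apply_of_le : ∀ m n, m ≤ n → g m (x n) = 1
  g_apply_of_lt : ∀ m n, n < m → g m (x n) = 0

/-- An element `F` of the bidual outside `X` and a functional `Φ` of the third dual that vanishes
on `X` but not at `F` give a triangular system: Helly's theorem for `Φ` yields the next `g`,
annihilating the vectors chosen before, and Helly's theorem for `F` the next `x`. -/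
theorem exists_jamesSystem {X : Type*} [NormedAddCommGroup X] [NormedSpace ℝ X] [CompleteSpace X]
    (hX : ¬ IsReflexiveSpace X) : Nonempty (JamesSystem X) := by
  obtain ⟨F, hF⟩ : ∃ F, ∀ x, NormedSpace.inclusionInDoubleDual ℝ X x ≠ F := by
    simpa [IsReflexiveSpace, Function.Surjective] using hX
  let J := NormedSpace.inclusionInDoubleDualLi (E := X) ℝ
  have hclosed : IsClosed (LinearMap.range J.toLinearMap : Set (StrongDual ℝ (StrongDual ℝ X))) :=
    J.isometry.isUniformInducing.isComplete_range.isClosed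
  obtain ⟨Φ, hΦF, hΦ⟩ : ∃ Φ : StrongDual ℝ (StrongDual ℝ (StrongDual ℝ X)),
      Φ F = 1 ∧ ∀ x, Φ (NormedSpace.inclusionInDoubleDual ℝ X x) = 0 := by
    obtain ⟨ψ, hψ, hψF⟩ : ∃ ψ : StrongDual ℝ (StrongDual ℝ (StrongDual ℝ X)),
        (∀ x, ψ (NormedSpace.inclusionInDoubleDual ℝ X x) = 0) ∧ ψ F ≠ 0 := by
      obtain ⟨ψ, hψF, hψ⟩ := exists_dual_ne_zero_of_notMem hclosed
        (v := F) (by rintro ⟨x, hx⟩; exact hF x hx)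
      exact ⟨ψ, fun x => hψ _ ⟨x, rfl⟩, hψF⟩
    exact ⟨(ψ F)⁻¹ • ψ, by simp [hψF], fun x => by simp [hψ x]⟩
  classical
  obtain ⟨C₁, hC₁⟩ := exists_bound_forall_finset_apply_eq F
  obtain ⟨C₂, hC₂⟩ := exists_bound_forall_finset_apply_eq Φ
  obtain ⟨s, hs, hr⟩ := exists_seq_of_forall_finset_exists
    (fun p : X × StrongDual ℝ X =>
      ‖p.1‖ ≤ max C₁ C₂ ∧ ‖p.2‖ ≤ max C₁ C₂ ∧ F p.2 = 1 ∧ p.2 p.1 = 1)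
    (fun p q => q.2 p.1 = 0 ∧ p.2 q.1 = 1) (by
      intro t ht
      obtain ⟨g, hg, hgt⟩ :=
        hC₂ (insert F (t.image fun p => NormedSpace.inclusionInDoubleDual ℝ X p.1))
      have hgF : F g = 1 := (hgt F (Finset.mem_insert_self _ _)).trans hΦF
      obtain ⟨y, hy, hyt⟩ := hC₁ (insert g (t.image Prod.snd))
      refine ⟨(y, g), ⟨hy.trans (le_max_left _ _), hg.trans (le_max_right _ _), hgF,
        (hyt g (Finset.mem_insert_self _ _)).trans hgF⟩, fun p hp => ⟨?_, ?_⟩⟩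
      · exact (hgt _ (Finset.mem_insert_of_mem (Finset.mem_image_of_mem _ hp))).trans (hΦ p.1)
      · exact (hyt _ (Finset.mem_insert_of_mem (Finset.mem_image_of_mem _ hp))).trans
          (ht p hp).2.2.1)
  refine ⟨⟨fun n => (s n).1, fun m => (s m).2, max C₁ C₂, fun n => (hs n).1, fun m => (hs m).2.1,
    fun m n hmn => ?_, fun m n hnm => (hr n m hnm).1⟩⟩
  obtain rfl | hlt := hmn.eq_or_lt
  · exact (hs m).2.2.2
  · exact (hr m n hlt).2

/-! ### Seminorms -/

/-- The seminorm `√(p² + q²)`. -/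
noncomputable def Seminorm.hypot {V : Type*} [AddCommGroup V] [Module ℝ V] (p q : Seminorm ℝ V) :
    Seminorm ℝ V :=
  Seminorm.of (fun z => √(p z ^ 2 + q z ^ 2))
    (fun y z => by
      rw [Real.sqrt_le_left (by positivity)]
      have h1 := map_add_le_add p y z
      have h2 := map_add_le_add q y z
      have ha := Real.sq_sqrt (show 0 ≤ p y ^ 2 + q y ^ 2 by positivity)
      have hb := Real.sq_sqrt (show 0 ≤ p z ^ 2 + q z ^ 2 by positivity)
      have hab : p y * p z + q y * q z ≤ √(p y ^ 2 + q y ^ 2) * √(p z ^ 2 + q z ^ 2) := by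
        rw [← Real.sqrt_mul (by positivity)]
        exact Real.le_sqrt_of_sq_le (by nlinarith [sq_nonneg (p y * q z - q y * p z)])
      have h1' : p (y + z) ^ 2 ≤ (p y + p z) ^ 2 := by gcongr
      have h2' : q (y + z) ^ 2 ≤ (q y + q z) ^ 2 := by gcongr
      nlinarith)
    (fun a z => by
      rw [map_smul_eq_mul, map_smul_eq_mul,
        show (‖a‖ * p z) ^ 2 + (‖a‖ * q z) ^ 2 = ‖a‖ ^ 2 * (p z ^ 2 + q z ^ 2) by ring,
        Real.sqrt_mul (by positivity), Real.sqrt_sq (norm_nonneg a)])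

namespace Seminorm

variable {V : Type*} [AddCommGroup V] [Module ℝ V] (p q : Seminorm ℝ V) (z : V)

theorem hypot_apply : p.hypot q z = √(p z ^ 2 + q z ^ 2) := rfl

theorem hypot_sq : p.hypot q z ^ 2 = p z ^ 2 + q z ^ 2 := Real.sq_sqrt (by positivity)

theorem le_hypot_left : p z ≤ p.hypot q z :=
  Real.le_sqrt_of_sq_le (by linarith [sq_nonneg (q z)])

theorem le_hypot_right : q z ≤ p.hypot q z :=
  Real.le_sqrt_of_sq_le (by linarith [sq_nonneg (p z)])

theorem hypot_le_add : p.hypot q z ≤ p z + q z := by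
  have hp := apply_nonneg p z
  have hq := apply_nonneg q z
  rw [hypot_apply, Real.sqrt_le_left (by positivity)]
  nlinarith [mul_nonneg hp hq]

theorem hypot_eq_left (h : q z = 0) : p.hypot q z = p z := by
  rw [hypot_apply, h]
  simp [Real.sqrt_sq (apply_nonneg p z)]

end Seminorm

/-! ### The renorming attached to a triangular system -/

namespace JamesSystem

variable {X : Type*} [NormedAddCommGroup X] [NormedSpace ℝ X] (S : JamesSystem X)

theorem one_le_bound : 1 ≤ S.bound := by
  have h0 : 0 ≤ S.bound := (norm_nonneg _).trans (S.norm_x_le 0)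
  have h : ‖S.g 0 (S.x 0)‖ ≤ S.bound * S.bound :=
    ((S.g 0).le_opNorm _).trans
      (mul_le_mul (S.norm_g_le 0) (S.norm_x_le 0) (norm_nonneg _) h0)
  rw [S.g_apply_of_le 0 0 le_rfl, norm_one] at h
  nlinarith

theorem bound_pos : 0 < S.bound := zero_lt_one.trans_le S.one_le_bound

/-- The functional that exposes `S.x 0`; it vanishes at all other vectors of the system. -/
noncomputable def exposing : StrongDual ℝ X := S.g 0 - S.g 1

@[simp]
theorem exposing_x_zero : S.exposing (S.x 0) = 1 := by
  simp [exposing, S.g_apply_of_le 0 0 le_rfl, S.g_apply_of_lt 1 0 one_pos]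

@[simp]
theorem exposing_x_succ (n : ℕ) : S.exposing (S.x (n + 1)) = 0 := by
  simp [exposing, S.g_apply_of_le 0 (n + 1) (by simp), S.g_apply_of_le 1 (n + 1) (by simp)]

/-- Weights in `[1 / 2, 1)` increasing to `1`. -/
noncomputable def weight (m : ℕ) : ℝ := 1 - 1 / ((m : ℝ) + 2)

theorem weight_lt_one (m : ℕ) : weight m < 1 := by
  have : 0 < 1 / ((m : ℝ) + 2) := by positivity
  unfold weight
  linarith

theorem half_le_weight (m : ℕ) : 1 / 2 ≤ weight m := by
  have : 1 / ((m : ℝ) + 2) ≤ 1 / 2 :=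
    one_div_le_one_div_of_le two_pos (by linarith [m.cast_nonneg (α := ℝ)])
  unfold weight
  linarith

theorem weight_pos (m : ℕ) : 0 < weight m := by linarith [half_le_weight m]

theorem weight_mono : Monotone weight := fun m n h => by
  have : 1 / ((n : ℝ) + 2) ≤ 1 / ((m : ℝ) + 2) :=
    one_div_le_one_div_of_le (by positivity) (by gcongr)
  unfold weight
  linarith

theorem tendsto_weight : Tendsto weight atTop (𝓝 1) := by
  have h : Tendsto (fun m : ℕ => 1 / ((m : ℝ) + 2)) atTop (𝓝 0) := by
    simp only [one_div]
    exact tendsto_inv_atTop_zero.comp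
      (tendsto_atTop_add_const_right _ _ tendsto_natCast_atTop_atTop)
  rw [show (1 : ℝ) = 1 - 0 by ring]
  exact h.const_sub 1

/-- The functionals that prevent almost rotundity: they take at `S.x 0` values tending to `1`,
and each of them is constant along the tail of the remaining vectors of the system. -/
noncomputable def flattening (m : ℕ) : StrongDual ℝ X := weight m • (S.exposing + S.g (m + 1))

@[simp]
theorem flattening_x_zero (m : ℕ) : S.flattening m (S.x 0) = weight m := by
  simp [flattening, S.g_apply_of_lt (m + 1) 0 m.succ_pos]

theorem flattening_x_succ_of_le {m n : ℕ} (h : m ≤ n) :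
    S.flattening m (S.x (n + 1)) = weight m := by
  simp [flattening, S.g_apply_of_le (m + 1) (n + 1) (by omega)]

theorem flattening_x_succ_of_lt {m n : ℕ} (h : n < m) : S.flattening m (S.x (n + 1)) = 0 := by
  simp [flattening, S.g_apply_of_lt (m + 1) (n + 1) (by omega)]

theorem abs_exposing_le (z : X) : |S.exposing z| ≤ 2 * S.bound * ‖z‖ := by
  refine ((S.exposing).le_opNorm z).trans ?_
  gcongr
  refine (norm_sub_le _ _).trans ?_
  linarith [S.norm_g_le 0, S.norm_g_le 1]

theorem abs_flattening_le (m : ℕ) (z : X) : |S.flattening m z| ≤ 3 * S.bound * ‖z‖ := by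
  have h1 := S.abs_exposing_le z
  have h2 : |S.g (m + 1) z| ≤ S.bound * ‖z‖ :=
    ((S.g (m + 1)).le_opNorm z).trans (by gcongr; exact S.norm_g_le _)
  have h3 : S.flattening m z = weight m * (S.exposing z + S.g (m + 1) z) := rfl
  rw [h3, abs_mul, abs_of_pos (weight_pos m)]
  refine (mul_le_of_le_one_left (abs_nonneg _) (weight_lt_one m).le).trans ?_
  refine (abs_add_le _ _).trans ?_
  linarith

/-- The absolute value of a functional, as a seminorm. -/
noncomputable def _root_.StrongDual.absSeminorm (φ : StrongDual ℝ X) : Seminorm ℝ X :=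
  (normSeminorm ℝ ℝ).comp φ.toLinearMap

theorem _root_.StrongDual.absSeminorm_apply (φ : StrongDual ℝ X) (z : X) :
    StrongDual.absSeminorm φ z = |φ z| := rfl

/-- A multiple of the distance from `z` to `S.exposing z • S.x 0`; the factor makes its value at
the other vectors of the system at most `1 / 2`. -/
noncomputable def transversal : Seminorm ℝ X :=
  (normSeminorm ℝ X).comp ((2 * S.bound)⁻¹ •
    (LinearMap.id - S.exposing.toLinearMap.smulRight (S.x 0)))

theorem transversal_apply (z : X) :
    S.transversal z = (2 * S.bound)⁻¹ * ‖z - S.exposing z • S.x 0‖ := by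
  have := S.bound_pos
  simp [transversal, Seminorm.comp_apply, norm_smul, abs_of_pos this]

/-- A norm whose unit ball is strongly exposed at `S.x 0` by `S.exposing`. -/
noncomputable def roundPart : Seminorm ℝ X :=
  (StrongDual.absSeminorm S.exposing).hypot S.transversal

/-- The supremum of the absolute values of the flattening functionals. -/
noncomputable def flatPart : Seminorm ℝ X := ⨆ m, StrongDual.absSeminorm (S.flattening m)

/-- The span of the vectors of the system. -/
def span : Submodule ℝ X := Submodule.span ℝ (Set.range S.x)

theorem x_mem_span (n : ℕ) : S.x n ∈ S.span := Submodule.subset_span ⟨n, rfl⟩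

/-- The distance to the span of the system. -/
noncomputable def distPart : Seminorm ℝ X := (normSeminorm ℝ (X ⧸ S.span)).comp S.span.mkQ

/-- The part of the renorming that does not see the distance to the span of the system. -/
noncomputable def innerPart : Seminorm ℝ X := S.roundPart ⊔ S.flatPart

/-- The renorming. On the span of the system it is `S.innerPart`; the distance to the span is
added quadratically, which forces sequences maximizing a norming functional of `S.x 0` to
approach the span. -/
noncomputable def renorm : Seminorm ℝ X := S.innerPart.hypot S.distPart

theorem bddAbove_flattening :
    BddAbove (Set.range fun m => StrongDual.absSeminorm (S.flattening m)) := by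
  rw [Seminorm.bddAbove_range_iff]
  rintro z
  refine ⟨3 * S.bound * ‖z‖, ?_⟩
  rintro _ ⟨m, rfl⟩
  exact S.abs_flattening_le m z

theorem abs_flattening_le_flatPart (m : ℕ) (z : X) : |S.flattening m z| ≤ S.flatPart z :=
  le_ciSup S.bddAbove_flattening m z

theorem flatPart_le {z : X} {r : ℝ} (h : ∀ m, |S.flattening m z| ≤ r) : S.flatPart z ≤ r := by
  rw [flatPart, Seminorm.iSup_apply S.bddAbove_flattening]
  exact ciSup_le h

theorem roundPart_le_innerPart (z : X) : S.roundPart z ≤ S.innerPart z := le_max_left _ _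

theorem flatPart_le_innerPart (z : X) : S.flatPart z ≤ S.innerPart z := le_max_right _ _

theorem innerPart_le_renorm (z : X) : S.innerPart z ≤ S.renorm z := Seminorm.le_hypot_left _ _ z

theorem distPart_le_norm (z : X) : S.distPart z ≤ ‖z‖ := Submodule.Quotient.norm_mk_le S.span z

theorem distPart_eq_zero {z : X} (hz : z ∈ S.span) : S.distPart z = 0 := by
  change ‖(Submodule.Quotient.mk z : X ⧸ S.span)‖ = 0
  rw [(Submodule.Quotient.mk_eq_zero S.span).2 hz, norm_zero]

theorem renorm_eq_innerPart {z : X} (hz : z ∈ S.span) : S.renorm z = S.innerPart z :=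
  Seminorm.hypot_eq_left _ _ z (S.distPart_eq_zero hz)

/-- A functional vanishing on the span of the system is controlled by the distance to it. -/
theorem abs_le_mul_distPart {k : X →ₗ[ℝ] ℝ} {K : ℝ} (hK : 0 ≤ K) (hk : ∀ z, |k z| ≤ K * ‖z‖)
    (hspan : ∀ z ∈ S.span, k z = 0) (z : X) : |k z| ≤ K * S.distPart z := by
  have key : ∀ ε : ℝ, 0 < ε → |k z| ≤ K * (S.distPart z + ε) := fun ε hε => by
    obtain ⟨y, hy, hlt⟩ := Submodule.Quotient.norm_mk_lt (Submodule.Quotient.mk z : X ⧸ S.span) hε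
    have hyz : k (y - z) = 0 := hspan _ ((Submodule.Quotient.eq _).1 hy)
    rw [map_sub, sub_eq_zero] at hyz
    rw [← hyz]
    exact (hk y).trans (mul_le_mul_of_nonneg_left hlt.le hK)
  have hlim : Tendsto (fun ε : ℝ => K * (S.distPart z + ε)) (𝓝[>] 0) (𝓝 (K * S.distPart z)) := by
    have : Continuous fun ε : ℝ => K * (S.distPart z + ε) := by fun_prop
    simpa using (this.tendsto 0).mono_left nhdsWithin_le_nhds
  exact ge_of_tendsto hlim (eventually_mem_nhdsWithin.mono fun ε hε => key ε hε)

theorem norm_sub_exposing_le (z : X) :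
    ‖z - S.exposing z • S.x 0‖ ≤ (1 + 2 * S.bound * S.bound) * ‖z‖ := by
  refine (norm_sub_le _ _).trans ?_
  rw [norm_smul, Real.norm_eq_abs]
  have := mul_le_mul (S.abs_exposing_le z) (S.norm_x_le 0) (norm_nonneg _)
    (mul_nonneg (by linarith [S.bound_pos]) (norm_nonneg z))
  nlinarith

theorem exists_renorm_le : ∃ C : ℝ, 0 < C ∧ ∀ z, S.renorm z ≤ C * ‖z‖ := by
  have hB := S.bound_pos
  refine ⟨2 * S.bound + (2 * S.bound)⁻¹ * (1 + 2 * S.bound * S.bound) + 3 * S.bound + 1,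
    by positivity, fun z => ?_⟩
  have h1 : S.roundPart z ≤
      2 * S.bound * ‖z‖ + (2 * S.bound)⁻¹ * ((1 + 2 * S.bound * S.bound) * ‖z‖) := by
    refine (Seminorm.hypot_le_add _ _ z).trans (add_le_add (S.abs_exposing_le z) ?_)
    rw [transversal_apply]
    gcongr
    exact S.norm_sub_exposing_le z
  have h2 : S.flatPart z ≤ 3 * S.bound * ‖z‖ := S.flatPart_le fun m => S.abs_flattening_le m z
  have h3 : S.innerPart z ≤ S.roundPart z + S.flatPart z :=
    max_le_add_of_nonneg (apply_nonneg _ _) (apply_nonneg _ _)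
  have h4 : S.renorm z ≤ S.innerPart z + S.distPart z := Seminorm.hypot_le_add _ _ z
  have h5 := S.distPart_le_norm z
  linarith

theorem abs_exposing_le_roundPart (z : X) : |S.exposing z| ≤ S.roundPart z :=
  Seminorm.le_hypot_left (StrongDual.absSeminorm S.exposing) S.transversal z

theorem abs_exposing_le_renorm (z : X) : |S.exposing z| ≤ S.renorm z :=
  (S.abs_exposing_le_roundPart z).trans
    ((S.roundPart_le_innerPart z).trans (S.innerPart_le_renorm z))

theorem norm_le_renorm (z : X) : ‖z‖ ≤ 3 * S.bound * S.renorm z := by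
  have hB := S.bound_pos
  have h1 := S.abs_exposing_le_renorm z
  have h2 : S.transversal z ≤ S.renorm z :=
    (Seminorm.le_hypot_right _ _ z).trans
      ((S.roundPart_le_innerPart z).trans (S.innerPart_le_renorm z))
  rw [transversal_apply, inv_mul_le_iff₀ (by positivity)] at h2
  have h3 : ‖z‖ ≤ ‖z - S.exposing z • S.x 0‖ + ‖S.exposing z • S.x 0‖ := by
    simpa using norm_add_le (z - S.exposing z • S.x 0) (S.exposing z • S.x 0)
  rw [norm_smul, Real.norm_eq_abs] at h3
  have h4 := mul_le_mul h1 (S.norm_x_le 0) (norm_nonneg _) (apply_nonneg _ _)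
  linarith

/-- The renorming, as an equivalent norm. -/
noncomputable def equivNorm : EquivNorm X where
  toSeminorm := S.renorm
  equiv' := by
    obtain ⟨C, hC, h⟩ := S.exists_renorm_le
    have hB := S.bound_pos
    exact ⟨(3 * S.bound)⁻¹, C, by positivity, hC, fun z =>
      ⟨(inv_mul_le_iff₀ (by positivity)).2 (S.norm_le_renorm z), h z⟩⟩

theorem renorm_x_zero : S.renorm (S.x 0) = 1 := by
  rw [S.renorm_eq_innerPart (S.x_mem_span 0)]
  have h1 : S.roundPart (S.x 0) = 1 := by
    rw [roundPart, Seminorm.hypot_eq_left _ _ _ (by simp [transversal_apply]),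
      StrongDual.absSeminorm_apply]
    simp
  refine (max_eq_left ?_).trans h1
  refine (S.flatPart_le fun m => ?_).trans_eq h1.symm
  rw [flattening_x_zero, abs_of_pos (weight_pos m)]
  exact (weight_lt_one m).le

theorem renorm_x_succ (n : ℕ) : S.renorm (S.x (n + 1)) = weight n := by
  have hB := S.bound_pos
  rw [S.renorm_eq_innerPart (S.x_mem_span _)]
  refine le_antisymm (max_le ?_ (S.flatPart_le fun m => ?_)) ?_
  · refine (Seminorm.hypot_le_add _ _ _).trans ?_
    rw [StrongDual.absSeminorm_apply, transversal_apply]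
    simp only [exposing_x_succ, abs_zero, zero_smul, sub_zero, zero_add]
    rw [inv_mul_le_iff₀ (by positivity)]
    have := mul_le_mul_of_nonneg_left (half_le_weight n) (show 0 ≤ 2 * S.bound by positivity)
    linarith [S.norm_x_le (n + 1)]
  · obtain h | h := le_or_gt m n
    · rw [S.flattening_x_succ_of_le h, abs_of_pos (weight_pos m)]
      exact weight_mono h
    · rw [S.flattening_x_succ_of_lt h, abs_zero]
      exact (weight_pos n).le
  · refine le_trans ?_ (S.flatPart_le_innerPart _)
    refine le_trans ?_ (S.abs_flattening_le_flatPart n _)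
    rw [S.flattening_x_succ_of_le le_rfl]
    exact le_abs_self _

/-! ### Norming functionals of the first vector -/

theorem exists_forall_ge_g_apply_eq_zero {z : X} (hz : z ∈ S.span) :
    ∃ m₀, ∀ m, m₀ ≤ m → S.g m z = 0 := by
  induction hz using Submodule.span_induction with
  | mem y hy =>
    obtain ⟨n, rfl⟩ := hy
    exact ⟨n + 1, fun m hm => S.g_apply_of_lt m n hm⟩
  | zero => exact ⟨0, fun m _ => map_zero _⟩
  | add y z _ _ hy hz =>
    obtain ⟨a, ha⟩ := hy
    obtain ⟨b, hb⟩ := hz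
    refine ⟨max a b, fun m hm => ?_⟩
    rw [map_add, ha m (le_of_max_le_left hm), hb m (le_of_max_le_right hm), add_zero]
  | smul c y _ hy =>
    obtain ⟨a, ha⟩ := hy
    exact ⟨a, fun m hm => by rw [map_smul, ha m hm, smul_zero]⟩

/-- Near `S.x 0` the flat part does not contribute to the norm along a direction `w` of the
span in the kernel of `S.exposing`: only finitely many flattening functionals are nonzero at `w`,
and all of them are less than `1` at `S.x 0`. -/
theorem eventually_flatPart_le_one {w : X} (hw : w ∈ S.span) (hfw : S.exposing w = 0) :
    ∀ᶠ s : ℝ in 𝓝 0, S.flatPart (S.x 0 + s • w) ≤ 1 := by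
  obtain ⟨m₀, hm₀⟩ := S.exists_forall_ge_g_apply_eq_zero hw
  have hfin : ∀ᶠ s : ℝ in 𝓝 0, ∀ m ∈ Finset.range m₀, |S.flattening m (S.x 0 + s • w)| < 1 := by
    rw [Filter.eventually_all_finset]
    intro m _
    have hcont : Continuous fun s : ℝ => |S.flattening m (S.x 0 + s • w)| := by fun_prop
    refine hcont.continuousAt.eventually_lt continuousAt_const ?_
    rw [zero_smul, add_zero, flattening_x_zero, abs_of_pos (weight_pos m)]
    exact weight_lt_one m
  filter_upwards [hfin] with s hs
  refine S.flatPart_le fun m => ?_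
  obtain h | h := lt_or_ge m m₀
  · exact (hs m (Finset.mem_range.2 h)).le
  · have hmw : S.flattening m w = 0 := by
      simp [flattening, hfw, hm₀ (m + 1) (by omega)]
    rw [map_add, map_smul, hmw, smul_zero, add_zero, flattening_x_zero, abs_of_pos (weight_pos m)]
    exact (weight_lt_one m).le

/-- A functional norming `S.x 0` agrees with `S.exposing` on the span of the system, because the
restriction of the renorming to the span is Gateaux differentiable at `S.x 0`. -/
theorem apply_eq_exposing {h : X →ₗ[ℝ] ℝ} (hle : ∀ z, |h z| ≤ S.renorm z) (h0 : h (S.x 0) = 1)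
    {z : X} (hz : z ∈ S.span) : h z = S.exposing z := by
  set w : X := z - S.exposing z • S.x 0 with hw_def
  have hw : w ∈ S.span := S.span.sub_mem hz (S.span.smul_mem _ (S.x_mem_span 0))
  have hfw : S.exposing w = 0 := by simp [hw_def]
  suffices hhw : h w = 0 by
    rw [hw_def, map_sub, map_smul, h0, smul_eq_mul, mul_one, sub_eq_zero] at hhw
    exact hhw
  set K : ℝ := ((2 * S.bound)⁻¹ * ‖w‖) ^ 2
  have hK : 0 ≤ K := sq_nonneg _
  have hev : ∀ᶠ s : ℝ in 𝓝 0, s * h w - K * s ^ 2 ≤ 0 := by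
    filter_upwards [S.eventually_flatPart_le_one hw hfw] with s hs
    have hmem : S.x 0 + s • w ∈ S.span :=
      S.span.add_mem (S.x_mem_span 0) (S.span.smul_mem _ hw)
    have hround : S.roundPart (S.x 0 + s • w) ≤ 1 + K * s ^ 2 := by
      have hsq : S.roundPart (S.x 0 + s • w) ^ 2 = 1 + K * s ^ 2 := by
        rw [roundPart, Seminorm.hypot_sq, StrongDual.absSeminorm_apply, transversal_apply]
        have h1 : S.exposing (S.x 0 + s • w) = 1 := by simp [hfw]
        rw [h1, one_smul, add_sub_cancel_left, norm_smul, Real.norm_eq_abs, mul_pow, mul_pow,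
          sq_abs, sq_abs]
        ring
      refine (sq_le_sq₀ (apply_nonneg _ _) (by positivity)).1 ?_
      rw [hsq]
      nlinarith [mul_nonneg hK (sq_nonneg s)]
    have hN : S.renorm (S.x 0 + s • w) ≤ 1 + K * s ^ 2 := by
      rw [S.renorm_eq_innerPart hmem]
      exact max_le hround (hs.trans (by nlinarith [mul_nonneg hK (sq_nonneg s)]))
    have := (le_abs_self _).trans ((hle (S.x 0 + s • w)).trans hN)
    rw [map_add, map_smul, h0, smul_eq_mul] at this
    linarith
  have hmax : IsLocalMax (fun s : ℝ => s * h w - K * s ^ 2) 0 := by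
    filter_upwards [hev] with s hs
    simpa using hs
  have hderiv : HasDerivAt (fun s : ℝ => s * h w - K * s ^ 2)
      (1 * h w - K * (((2 : ℕ) : ℝ) * 0 ^ (2 - 1))) 0 :=
    ((hasDerivAt_id (0 : ℝ)).mul_const (h w)).fun_sub ((hasDerivAt_pow 2 (0 : ℝ)).const_mul K)
  simpa using hmax.hasDerivAt_eq_zero hderiv

/-- The strong exposure of `S.x 0` by its norming functionals: along `u` the distance to the span
tends to `0`, so `h` may be replaced by `S.exposing`, and then the round part gives convergence. -/
theorem tendsto_renorm_sub {h : X →ₗ[ℝ] ℝ} (hle : ∀ z, |h z| ≤ S.renorm z) (h0 : h (S.x 0) = 1)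
    {u : ℕ → X} (hu : ∀ n, S.renorm (u n) ≤ 1) (hlim : Tendsto (fun n => h (u n)) atTop (𝓝 1)) :
    Tendsto (fun n => S.renorm (u n - S.x 0)) atTop (𝓝 0) := by
  have hB := S.bound_pos
  obtain ⟨C, hC, hNC⟩ := S.exists_renorm_le
  -- The midpoints of `u n` and `S.x 0` have norm tending to `1`. Since the distance part vanishes
  -- at `S.x 0`, this forces the distance part of `u n` to tend to `0`.
  have hdist : Tendsto (fun n => S.distPart (u n)) atTop (𝓝 0) := by
    have hL : Tendsto (fun n => √(1 - (((h (u n) + 1) ^ 2 - 2) / 2) ^ 2)) atTop (𝓝 0) := by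
      have hcont : Continuous fun t : ℝ => √(1 - (((t + 1) ^ 2 - 2) / 2) ^ 2) := by fun_prop
      have := (hcont.tendsto 1).comp hlim
      norm_num at this
      exact this
    have hpos : ∀ᶠ n in atTop, 1 / 2 < h (u n) := hlim.eventually_const_lt (by norm_num)
    refine squeeze_zero' (Eventually.of_forall fun n => apply_nonneg _ _) ?_ hL
    filter_upwards [hpos] with n hn
    apply Real.le_sqrt_of_sq_le
    have hsum : h (u n) + 1 ≤ S.renorm (u n + S.x 0) := by
      have := (le_abs_self _).trans (hle (u n + S.x 0))
      rwa [map_add, h0] at this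
    have hsq : (h (u n) + 1) ^ 2 ≤ S.renorm (u n + S.x 0) ^ 2 := by gcongr
    rw [renorm, Seminorm.hypot_sq] at hsq
    have hone : S.innerPart (S.x 0) = 1 := by
      rw [← S.renorm_eq_innerPart (S.x_mem_span 0), renorm_x_zero]
    have h1 : S.innerPart (u n + S.x 0) ≤ S.innerPart (u n) + 1 :=
      hone ▸ map_add_le_add S.innerPart _ _
    have h2 : S.distPart (u n + S.x 0) ≤ S.distPart (u n) := by
      simpa [S.distPart_eq_zero (S.x_mem_span 0)] using map_add_le_add S.distPart (u n) (S.x 0)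
    have h1' : S.innerPart (u n + S.x 0) ^ 2 ≤ (S.innerPart (u n) + 1) ^ 2 := by gcongr
    have h2' : S.distPart (u n + S.x 0) ^ 2 ≤ S.distPart (u n) ^ 2 := by gcongr
    have h3 : S.innerPart (u n) ^ 2 + S.distPart (u n) ^ 2 ≤ 1 := by
      rw [← Seminorm.hypot_sq]
      exact pow_le_one₀ (apply_nonneg _ _) (hu n)
    have h4 : ((h (u n) + 1) ^ 2 - 2) / 2 ≤ S.innerPart (u n) := by nlinarith
    have h5 : (((h (u n) + 1) ^ 2 - 2) / 2) ^ 2 ≤ S.innerPart (u n) ^ 2 :=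
      pow_le_pow_left₀ (by nlinarith) h4 2
    linarith
  have hexp : Tendsto (fun n => S.exposing (u n)) atTop (𝓝 1) := by
    have hdiff : ∀ z, |(h - S.exposing.toLinearMap) z| ≤ (C + C) * S.distPart z := by
      refine S.abs_le_mul_distPart (by positivity) (fun z => ?_) fun z hz => ?_
      · refine (abs_sub _ _).trans ?_
        have h1 := (hle z).trans (hNC z)
        have h2 := (S.abs_exposing_le_renorm z).trans (hNC z)
        rw [add_mul]
        exact add_le_add h1 h2
      · exact sub_eq_zero.2 (S.apply_eq_exposing hle h0 hz)
    have hzero : Tendsto (fun n => h (u n) - S.exposing (u n)) atTop (𝓝 0) :=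
      squeeze_zero_norm (fun n => hdiff (u n)) (by simpa using hdist.const_mul (C + C))
    simpa using hlim.sub hzero
  have hnorm : Tendsto (fun n => ‖u n - S.exposing (u n) • S.x 0‖) atTop (𝓝 0) := by
    have hL : Tendsto (fun n => 2 * S.bound * √(1 - S.exposing (u n) ^ 2)) atTop (𝓝 0) := by
      have hcont : Continuous fun t : ℝ => 2 * S.bound * √(1 - t ^ 2) := by fun_prop
      have := (hcont.tendsto 1).comp hexp
      norm_num at this
      exact this
    refine squeeze_zero (fun n => norm_nonneg _) (fun n => ?_) hL
    rw [← inv_mul_le_iff₀ (by positivity), ← transversal_apply]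
    apply Real.le_sqrt_of_sq_le
    have hr : S.roundPart (u n) ^ 2 ≤ 1 :=
      pow_le_one₀ (apply_nonneg _ _)
        ((S.roundPart_le_innerPart _).trans ((S.innerPart_le_renorm _).trans (hu n)))
    rw [roundPart, Seminorm.hypot_sq, StrongDual.absSeminorm_apply, sq_abs] at hr
    linarith
  have hL : Tendsto (fun n => C * (‖u n - S.exposing (u n) • S.x 0‖ +
      |S.exposing (u n) - 1| * ‖S.x 0‖)) atTop (𝓝 0) := by
    have h1 : Tendsto (fun n => |S.exposing (u n) - 1|) atTop (𝓝 0) := by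
      simpa using (hexp.sub_const 1).abs
    simpa using (hnorm.add (h1.mul_const ‖S.x 0‖)).const_mul C
  refine squeeze_zero (fun n => apply_nonneg _ _) (fun n => (hNC _).trans ?_) hL
  gcongr
  rw [← Real.norm_eq_abs, ← norm_smul]
  refine le_trans (le_of_eq ?_) (norm_add_le _ _)
  congr 1
  module

/-! ### The renormed space -/

theorem isNSE : IsNSE (S.equivNorm.toSpace (S.x 0)) := by
  rintro φ ⟨hφ, hφx⟩ u hu hlim
  rw [tendsto_iff_norm_sub_tendsto_zero]
  refine S.tendsto_renorm_sub (h := φ.toLinearMap.comp S.equivNorm.toSpace.toLinearMap)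
    (u := fun n => S.equivNorm.toSpace.symm (u n)) (fun z => ?_) hφx hu hlim
  have := φ.le_opNorm (S.equivNorm.toSpace z)
  rwa [hφ, one_mul] at this

theorem not_isWeakALUR : ¬ IsWeakALUR (S.equivNorm.toSpace (S.x 0)) := by
  intro hw
  let T := S.equivNorm.toSpace
  -- The renormed versions of the functionals involved.
  let lift (φ : StrongDual ℝ X) (hφ : ∀ z, |φ z| ≤ S.renorm z) :
      StrongDual ℝ S.equivNorm.Space :=
    (φ.toLinearMap.comp T.symm.toLinearMap).mkContinuous 1 fun z => by
      rw [one_mul]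
      exact hφ (T.symm z)
  have hflat : ∀ m z, |S.flattening m z| ≤ S.renorm z := fun m z =>
    (S.abs_flattening_le_flatPart m z).trans
      ((S.flatPart_le_innerPart z).trans (S.innerPart_le_renorm z))
  let u : ℕ → S.equivNorm.Space := fun n => (weight n)⁻¹ • T (S.x (n + 1))
  let f : ℕ → StrongDual ℝ S.equivNorm.Space := fun m => lift (S.flattening m) (hflat m)
  have hu : ∀ n, ‖u n‖ = 1 := fun n => by
    rw [norm_smul, norm_inv, Real.norm_eq_abs, abs_of_pos (weight_pos n),
      EquivNorm.norm_toSpace]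
    change (weight n)⁻¹ * S.renorm _ = 1
    rw [renorm_x_succ, inv_mul_cancel₀ (weight_pos n).ne']
  have hfu : ∀ m n, m ≤ n → f m (u n) = (weight n)⁻¹ * weight m := fun m n hmn => by
    rw [map_smul, smul_eq_mul]
    congr 1
    exact S.flattening_x_succ_of_le hmn
  have hfx : ∀ m, f m (T (S.x 0)) = weight m := fun m => S.flattening_x_zero m
  have hf : ∀ m, ‖f m‖ = 1 := fun m => by
    refine le_antisymm (LinearMap.mkContinuous_norm_le _ zero_le_one _) ?_
    have := (f m).le_opNorm (u m)
    rwa [hfu m m le_rfl, inv_mul_cancel₀ (weight_pos m).ne', norm_one, hu, mul_one] at this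
  have hlim : IteratedLimitOne (T (S.x 0)) u f := by
    refine ⟨weight, fun m => ?_, tendsto_weight⟩
    have h1 : Tendsto (fun n => 1 / 2 * ((weight n)⁻¹ * weight m + weight m)) atTop
        (𝓝 (weight m)) := by
      have := (((tendsto_weight.inv₀ one_ne_zero).mul_const (weight m)).add_const
        (weight m)).const_mul (1 / 2)
      convert this using 2
      ring
    refine h1.congr' ((eventually_ge_atTop m).mono fun n hn => ?_)
    beta_reduce
    rw [map_smul, map_add, hfu m n hn, hfx, smul_eq_mul]
  -- The functional `S.exposing` vanishes along `u` but not at `S.x 0`.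
  let e := lift S.exposing S.abs_exposing_le_renorm
  have hweak : Tendsto (fun n => e (u n)) atTop (𝓝 (e (T (S.x 0)))) :=
    ((WeakBilin.eval_continuous (topDualPairing ℝ S.equivNorm.Space).flip e).tendsto _).comp
      (hw u f hu hf hlim)
  have he0 : e (T (S.x 0)) = 1 := S.exposing_x_zero
  have heu : ∀ n, e (u n) = 0 := fun n => by
    rw [map_smul, show e (T (S.x (n + 1))) = 0 from S.exposing_x_succ n, smul_zero]
  rw [he0] at hweak
  simp only [heu] at hweak
  exact zero_ne_one (tendsto_nhds_unique tendsto_const_nhds hweak)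

end JamesSystem

theorem IsALUR.isWeakALUR {E : Type*} [NormedAddCommGroup E] [NormedSpace ℝ E] {x : E}
    (hx : IsALUR x) : IsWeakALUR x := fun u f hu hf hlim =>
  ((toWeakSpaceCLM ℝ E).continuous.tendsto x).comp (hx u f hu hf hlim)

theorem theorem3p6 {X : Type*} [NormedAddCommGroup X] [NormedSpace ℝ X] [CompleteSpace X]
    (hX : ¬ IsReflexiveSpace X) :
    ∃ (N : EquivNorm X) (x : N.Space),
      ‖x‖ = 1 ∧ IsNSE x ∧ ¬ IsWeakALUR x ∧ ¬ IsALUR x := by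
  obtain ⟨S⟩ := exists_jamesSystem hX
  exact ⟨S.equivNorm, S.equivNorm.toSpace (S.x 0), S.renorm_x_zero, S.isNSE, S.not_isWeakALUR,
    fun h => S.not_isWeakALUR h.isWeakALUR⟩
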